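/- Let $d_{i,j}\in[0,1]$ ($i,j\in\{-1,0,1\}$) be weights with $\sum_{i,j} d_{i,j}=1$, and let $t\in(0,1)$ be transcendental over the field $\mathbb{Q}(d_{i,j})$. Put $$S(x,y)=\sum_{i,j\in\{-1,0,1\}} d_{i,j}x^iy^j = A_{-1}(x)y^{-1}+A_0(x)+A_1(x)y = B_{-1}(y)x^{-1}+B_0(y)+B_1(y)x,$$ $$K(x,y,t)=xy\,(1-tS(x,y)),$$ and assume that the model is nondegenerate, i.e. that $K(x,y,t)$ is irreducible in $\mathbb{C}[x,y]$ and has degree $2$ in $x$ and degree $2$ in $y$. Let $$\overline{E_t}=\Big\{([x_0:x_1],[y_0:y_1])\in\mathbb{P}^1(\mathbb{C})\times\mathbb{P}^1(\mathbb{C}) : x_0x_1y_0y_1-t\sum_{i,j=0}^{2} d_{i-1,j-1}x_0^{i}x_1^{2-i}y_0^{j}y_1^{2-j}=0\Big\}$$ be the kernel curve, in which $(x,y)\in\mathbb{C}^2$ stands for the point $([x:1],[y:1])$. Consider the rational maps $\iota_1,\iota_2:\overline{E_t}\dashrightarrow\overline{E_t}$ given by $$\iota_1(x,y)=\Big(x,\frac{A_{-1}(x)}{A_1(x)\,y}\Big),\qquad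 \iota_2(x,y)=\Big(\frac{B_{-1}(y)}{B_1(y)\,x},y\Big)$$ at the points of $\overline{E_t}$ with $x,y\in\mathbb{C}\setminus\{0\}$ at which $A_1(x)\neq 0$ (resp. $B_1(y)\neq 0$); these are all but finitely many points of $\overline{E_t}$. Then $\iota_1$ and $\iota_2$ can be extended to involutive automorphisms of $\overline{E_t}$. That is, for each of them there is an involution $\overline{E_t}\to\overline{E_t}$ that agrees with the formula wherever the formula is defined and that is regular at every point $P$ of $\overline{E_t}$, singular or not (in affine charts containing $P$ and its image it is given near $P$ by rational functions whose denominators do not vanish at $P$). These extensions switch the two roots in $y$ (resp. in $x$): for every $P=(x,y)\in\overline{E_t}$, $$\{P,\iota_1(P)\}=\overline{E_t}\cap(\{x\}\times\mathbb{P}^1(\mathbb{C})),\qquad \{P,\iota_2(P)\}=\overline{E_t}\cap(\mathbb{P}^1(\mathbb{C})\times\{y\}).$$ -/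

import Mathlib

noncomputable section

namespace KernelCurve

/-! A weighted model of walks is given by a family `d : Fin 3 → Fin 3 → ℝ`, where `d i j` stands
for the weight `d_{i-1, j-1}` of the step `(i - 1, j - 1) ∈ {-1, 0, 1}²`. -/

/-- The field `ℚ(d_{i,j})`. -/
abbrev weightField (d : Fin 3 → Fin 3 → ℝ) : IntermediateField ℚ ℝ :=
  IntermediateField.adjoin ℚ {r : ℝ | ∃ i j, r = d i j}

/-- The kernel polynomial `K(x, y, t) = x y (1 - t S(x, y)) ∈ ℂ[x, y]`; the variable `x` is `X 0`
and the variable `y` is `X 1`. -/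
def kernelPoly (d : Fin 3 → Fin 3 → ℝ) (t : ℝ) : MvPolynomial (Fin 2) ℂ :=
  MvPolynomial.X 0 * MvPolynomial.X 1
    - MvPolynomial.C (t : ℂ) * ∑ i : Fin 3, ∑ j : Fin 3,
        MvPolynomial.C (d i j : ℂ) * MvPolynomial.X 0 ^ (i : ℕ) * MvPolynomial.X 1 ^ (j : ℕ)

/-- Degenerate models. -/
def Degenerate (d : Fin 3 → Fin 3 → ℝ) (t : ℝ) : Prop :=
  ¬ Irreducible (kernelPoly d t) ∨
    (kernelPoly d t).degreeOf 0 ≤ 1 ∨ (kernelPoly d t).degreeOf 1 ≤ 1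

/-- The bihomogeneous kernel polynomial, as a function of `x = (x₀, x₁)` and `y = (y₀, y₁)`. -/
def kernelBar (d : Fin 3 → Fin 3 → ℝ) (t : ℝ) (x y : Fin 2 → ℂ) : ℂ :=
  x 0 * x 1 * y 0 * y 1
    - (t : ℂ) * ∑ i : Fin 3, ∑ j : Fin 3,
        (d i j : ℂ) * x 0 ^ (i : ℕ) * x 1 ^ (2 - (i : ℕ)) * y 0 ^ (j : ℕ) * y 1 ^ (2 - (j : ℕ))

theorem kernelBar_affine (d : Fin 3 → Fin 3 → ℝ) (t : ℝ) (x y : ℂ) :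
    kernelBar d t ![x, 1] ![y, 1] = MvPolynomial.eval ![x, y] (kernelPoly d t) := by
  simp [kernelBar, kernelPoly]

theorem kernelBar_smul (d : Fin 3 → Fin 3 → ℝ) (t : ℝ) (a b : ℂ) (x y : Fin 2 → ℂ) :
    kernelBar d t (a • x) (b • y) = a ^ 2 * b ^ 2 * kernelBar d t x y := by
  simp [kernelBar, Fin.sum_univ_three]
  ring

/-- The complex projective line; `[x₀ : x₁]` is the class of `![x₀, x₁]`. -/
abbrev P1 : Type := Projectivization ℂ (Fin 2 → ℂ)

/-- The point `[z : 1]` of the projective line. -/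
def ofAffine (z : ℂ) : P1 :=
  Projectivization.mk ℂ ![z, 1] (fun h => one_ne_zero (congrFun h 1))

/-- The kernel curve in `ℙ¹(ℂ) × ℙ¹(ℂ)`: the zero set of the bihomogeneous kernel polynomial. -/
def curve (d : Fin 3 → Fin 3 → ℝ) (t : ℝ) : Set (P1 × P1) :=
  {P | kernelBar d t P.1.rep P.2.rep = 0}

/-- Membership in the kernel curve can be tested on any homogeneous coordinates. -/
theorem mk_mem_curve (d : Fin 3 → Fin 3 → ℝ) (t : ℝ) (x y : Fin 2 → ℂ) (hx : x ≠ 0) (hy : y ≠ 0) :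
    (Projectivization.mk ℂ x hx, Projectivization.mk ℂ y hy) ∈ curve d t ↔
      kernelBar d t x y = 0 := by
  obtain ⟨a, ha⟩ := Projectivization.exists_smul_eq_mk_rep ℂ x hx
  obtain ⟨b, hb⟩ := Projectivization.exists_smul_eq_mk_rep ℂ y hy
  have ha' : (a : ℂ) • x = (Projectivization.mk ℂ x hx).rep := ha
  have hb' : (b : ℂ) • y = (Projectivization.mk ℂ y hy).rep := hb
  simp [curve, ← ha', ← hb', kernelBar_smul]

/-- The affine coordinate of a point of `ℙ¹(ℂ)` in the chart `x_k ≠ 0`: it is `x₀ / x₁` for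
`k = 1` and `x₁ / x₀` for `k = 0`. It is only used for points of this chart. -/
def affCoord (k : Fin 2) (P : P1) : ℂ := P.rep (1 - k) / P.rep k

theorem affCoord_mk (k : Fin 2) (x : Fin 2 → ℂ) (hx : x ≠ 0) :
    affCoord k (Projectivization.mk ℂ x hx) = x (1 - k) / x k := by
  obtain ⟨a, ha⟩ := Projectivization.exists_smul_eq_mk_rep ℂ x hx
  have ha' : (a : ℂ) • x = (Projectivization.mk ℂ x hx).rep := ha
  simp only [affCoord, ← ha', Pi.smul_apply, smul_eq_mul]
  exact mul_div_mul_left _ _ a.ne_zero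

/-- The four standard affine charts of `ℙ¹(ℂ) × ℙ¹(ℂ)`. -/
def chart (k : Fin 2 × Fin 2) : Set (P1 × P1) :=
  {P | P.1.rep k.1 ≠ 0 ∧ P.2.rep k.2 ≠ 0}

/-- The two affine coordinates of a point in the chart `k`. -/
def chartCoord (k : Fin 2 × Fin 2) (P : P1 × P1) : Fin 2 → ℂ :=
  ![affCoord k.1 P.1, affCoord k.2 P.2]

/-- A map between subsets of `ℙ¹(ℂ) × ℙ¹(ℂ)` is regular at `P` if, in affine charts containing `P`
and `f P`, it is given near `P` (on the points of `X` in the chart at which the denominator `r`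
does not vanish) by rational functions whose (common) denominator does not vanish at `P`. -/
def IsRegularAt {X Y : Set (P1 × P1)} (f : X → Y) (P : X) : Prop :=
  ∃ (k l : Fin 2 × Fin 2) (p q r : MvPolynomial (Fin 2) ℂ),
    (P : P1 × P1) ∈ chart k ∧ (f P : P1 × P1) ∈ chart l ∧
    MvPolynomial.eval (chartCoord k P) r ≠ 0 ∧
    ∀ Q : X, (Q : P1 × P1) ∈ chart k → MvPolynomial.eval (chartCoord k Q) r ≠ 0 →
      (f Q : P1 × P1) ∈ chart l ∧
      chartCoord l (f Q) =
        ![MvPolynomial.eval (chartCoord k Q) p / MvPolynomial.eval (chartCoord k Q) r,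
          MvPolynomial.eval (chartCoord k Q) q / MvPolynomial.eval (chartCoord k Q) r]

/-- Morphisms: maps that are regular at every point. -/
def IsMorphism {X Y : Set (P1 × P1)} (f : X → Y) : Prop := ∀ P : X, IsRegularAt f P

/-- Automorphisms: morphisms with an inverse that is a morphism. -/
def IsAutomorphism {X : Set (P1 × P1)} (f : X → X) : Prop :=
  IsMorphism f ∧ ∃ g : X → X, IsMorphism g ∧ Function.LeftInverse g f ∧ Function.RightInverse g f

/-- `coeffA d j x` is `A_{j-1}(x) = ∑ i, d_{i-1, j-1} x ^ (i - 1)`, so that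
`S(x, y) = A_{-1}(x) y⁻¹ + A_0(x) + A_1(x) y`. -/
def coeffA (d : Fin 3 → Fin 3 → ℝ) (j : Fin 3) (x : ℂ) : ℂ :=
  ∑ i : Fin 3, (d i j : ℂ) * x ^ (((i : ℕ) : ℤ) - 1)

/-- `coeffB d i y` is `B_{i-1}(y) = ∑ j, d_{i-1, j-1} y ^ (j - 1)`, so that
`S(x, y) = B_{-1}(y) x⁻¹ + B_0(y) + B_1(y) x`. -/
def coeffB (d : Fin 3 → Fin 3 → ℝ) (i : Fin 3) (y : ℂ) : ℂ :=
  ∑ j : Fin 3, (d i j : ℂ) * y ^ (((j : ℕ) : ℤ) - 1)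

/-- The points with finite nonzero coordinates `x = x₀ / x₁` and `y = y₀ / y₁`. -/
def torus : Set (P1 × P1) :=
  {P | ∀ k : Fin 2, P.1.rep k ≠ 0 ∧ P.2.rep k ≠ 0}

/-- The set on which the formula for `ι₁` has no vanishing denominator. -/
def iota1Domain (d : Fin 3 → Fin 3 → ℝ) : Set (P1 × P1) :=
  {P | P ∈ torus ∧ coeffA d 2 (affCoord 1 P.1) ≠ 0}

/-- The formula `ι₁ : (x, y) ↦ (x, A_{-1}(x) / (A_1(x) y))`, meant on `iota1Domain d`. -/
def iota1 (d : Fin 3 → Fin 3 → ℝ) (P : P1 × P1) : P1 × P1 :=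
  (P.1, ofAffine (coeffA d 0 (affCoord 1 P.1) /
    (coeffA d 2 (affCoord 1 P.1) * affCoord 1 P.2)))

/-- The set on which the formula for `ι₂` has no vanishing denominator. -/
def iota2Domain (d : Fin 3 → Fin 3 → ℝ) : Set (P1 × P1) :=
  {P | P ∈ torus ∧ coeffB d 2 (affCoord 1 P.2) ≠ 0}

/-- The formula `ι₂ : (x, y) ↦ (B_{-1}(y) / (B_1(y) x), y)`, meant on `iota2Domain d`. -/
def iota2 (d : Fin 3 → Fin 3 → ℝ) (P : P1 × P1) : P1 × P1 :=
  (ofAffine (coeffB d 0 (affCoord 1 P.2) /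
    (coeffB d 2 (affCoord 1 P.2) * affCoord 1 P.1)), P.2)

end KernelCurve

end

noncomputable section

namespace KernelCurve

open MvPolynomial

/-! Over a fixed `x`, the kernel is a binary quadratic form in `(y₀, y₁)` with coefficients `c₂, c₁,
c₀`. Nondegeneracy forbids it from vanishing identically (`fibresProper_of_not_degenerate`), so each
fibre consists of two roots counted with multiplicity, and the extension of `ι₁` exchanges them.

By Vieta, the root conjugate to `y` is `[-c₁y₁ - c₂y₀ : c₂y₁]` where `y₁ ≠ 0` and `[c₀y₀ : -c₁y₀ -
c₀y₁]` where `y₀ ≠ 0`. These polynomial vectors never vanish on the curve (`conjVec_ne_zero`), so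
the exchange is regular everywhere and singular points need no separate treatment. The product of
the roots is `c₀ / c₂ = A₋₁ / A₁`, which recovers the given formula. The claim for `ι₂` follows by
exchanging the coordinates. -/

/-- The coefficient of `y₀ ^ j * y₁ ^ (2 - j)` in the bihomogeneous kernel polynomial. -/
def fibreCoeff (d : Fin 3 → Fin 3 → ℝ) (t : ℝ) (j : Fin 3) (x : Fin 2 → ℂ) : ℂ :=
  (if j = 1 then x 0 * x 1 else 0)
    - (t : ℂ) * ∑ i : Fin 3, (d i j : ℂ) * x 0 ^ (i : ℕ) * x 1 ^ (2 - (i : ℕ))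

theorem kernelBar_eq (d : Fin 3 → Fin 3 → ℝ) (t : ℝ) (x y : Fin 2 → ℂ) :
    kernelBar d t x y = fibreCoeff d t 2 x * y 0 ^ 2 + fibreCoeff d t 1 x * (y 0 * y 1)
      + fibreCoeff d t 0 x * y 1 ^ 2 := by
  simp [kernelBar, fibreCoeff, Fin.sum_univ_three]
  ring

theorem fibreCoeff_smul (d : Fin 3 → Fin 3 → ℝ) (t : ℝ) (j : Fin 3) (a : ℂ) (x : Fin 2 → ℂ) :
    fibreCoeff d t j (a • x) = a ^ 2 * fibreCoeff d t j x := by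
  fin_cases j <;> simp [fibreCoeff, Fin.sum_univ_three] <;> ring

/-- `y` and `z` are the two zeros of the kernel polynomial in the fibre over `x`, counted with
multiplicity. -/
def IsConj (d : Fin 3 → Fin 3 → ℝ) (t : ℝ) (x y z : Fin 2 → ℂ) : Prop :=
  ∃ l : ℂ, fibreCoeff d t 2 x = l * (y 1 * z 1) ∧
    fibreCoeff d t 1 x = -(l * (y 0 * z 1 + y 1 * z 0)) ∧ fibreCoeff d t 0 x = l * (y 0 * z 0)

theorem IsConj.symm {d : Fin 3 → Fin 3 → ℝ} {t : ℝ} {x y z : Fin 2 → ℂ}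
    (h : IsConj d t x y z) : IsConj d t x z y := by
  obtain ⟨l, h2, h1, h0⟩ := h
  exact ⟨l, by rw [h2]; ring, by rw [h1]; ring, by rw [h0]; ring⟩

theorem IsConj.smul {d : Fin 3 → Fin 3 → ℝ} {t : ℝ} {x y z : Fin 2 → ℂ} (a : ℂ) {b c : ℂ}
    (hb : b ≠ 0) (hc : c ≠ 0) (h : IsConj d t x y z) :
    IsConj d t (a • x) (b • y) (c • z) := by
  obtain ⟨l, h2, h1, h0⟩ := h
  refine ⟨a ^ 2 * l / (b * c), ?_, ?_, ?_⟩ <;>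
    simp only [fibreCoeff_smul, h2, h1, h0, Pi.smul_apply, smul_eq_mul] <;> field_simp

theorem IsConj.kernelBar_eq {d : Fin 3 → Fin 3 → ℝ} {t : ℝ} {x y z : Fin 2 → ℂ}
    (h : IsConj d t x y z) : ∃ l : ℂ, ∀ u,
      kernelBar d t x u = l * ((y 1 * u 0 - y 0 * u 1) * (z 1 * u 0 - z 0 * u 1)) := by
  obtain ⟨l, h2, h1, h0⟩ := h
  refine ⟨l, fun u => ?_⟩
  rw [KernelCurve.kernelBar_eq, h2, h1, h0]
  ring

/-! ### Nondegeneracy: no fibre lies in the curve -/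

/-- The kernel polynomial does not vanish identically on any fibre of the first projection. -/
def FibresProper (d : Fin 3 → Fin 3 → ℝ) (t : ℝ) : Prop :=
  ∀ x : Fin 2 → ℂ, x ≠ 0 → ∃ j, fibreCoeff d t j x ≠ 0

theorem degreeOf_kernelPoly_le (d : Fin 3 → Fin 3 → ℝ) (t : ℝ) (h : ∀ j, d 2 j = 0) :
    (kernelPoly d t).degreeOf 0 ≤ 1 := by
  refine (degreeOf_sub_le _ _ _).trans (max_le ?_ ?_)
  · refine (degreeOf_mul_le _ _ _).trans ?_
    simp [degreeOf_X]
  · refine (degreeOf_C_mul_le _ _ _).trans ?_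
    refine (degreeOf_sum_le _ _ _).trans (Finset.sup_le fun i _ => ?_)
    refine (degreeOf_sum_le _ _ _).trans (Finset.sup_le fun j _ => ?_)
    by_cases hi : i = 2
    · simp [hi, h]
    · refine (degreeOf_mul_le _ _ _).trans ?_
      have h1 : degreeOf 0 ((X 1 : MvPolynomial (Fin 2) ℂ) ^ (j : ℕ)) = 0 := by
        have := degreeOf_pow_le 0 (X 1 : MvPolynomial (Fin 2) ℂ) (j : ℕ)
        simpa [degreeOf_X] using this
      have h2 : degreeOf 0 ((X 0 : MvPolynomial (Fin 2) ℂ) ^ (i : ℕ)) ≤ i := by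
        simp
      have h3 := degreeOf_C_mul_le ((X 0 : MvPolynomial (Fin 2) ℂ) ^ (i : ℕ)) 0 (d i j : ℂ)
      omega

theorem kernelPoly_eq_linear_mul_add (d : Fin 3 → Fin 3 → ℝ) (t : ℝ) (z : ℂ) :
    ∃ g : MvPolynomial (Fin 2) ℂ, kernelPoly d t = (X 0 - C z) * g +
      (C (fibreCoeff d t 2 ![z, 1]) * X 1 ^ 2 + C (fibreCoeff d t 1 ![z, 1]) * X 1
        + C (fibreCoeff d t 0 ![z, 1])) := by
  refine ⟨X 1 - C (t : ℂ) * ∑ j : Fin 3,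
    (C (d 2 j : ℂ) * (X 0 + C z) + C (d 1 j : ℂ)) * X 1 ^ (j : ℕ), ?_⟩
  simp [kernelPoly, fibreCoeff, Fin.sum_univ_three]
  ring

/-- A fibre over `[z : 1]` contained in the curve would make `x - z` a factor of `K`; by
irreducibility the cofactor is constant, so `K` would have degree 0 in `y`. A fibre over `[1 : 0]`
would kill every coefficient of `x²`. -/
theorem fibresProper_of_not_degenerate {d : Fin 3 → Fin 3 → ℝ} {t : ℝ} (ht : t ≠ 0)
    (hnd : ¬ Degenerate d t) : FibresProper d t := by
  intro x hx
  by_contra! hc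
  simp only [Degenerate, not_or, not_not, not_le] at hnd
  obtain ⟨hirr, h0, h1⟩ := hnd
  by_cases hx1 : x 1 = 0
  · have hx0 : x 0 ≠ 0 := fun h => hx (by ext i; fin_cases i <;> simp [h, hx1])
    refine absurd (degreeOf_kernelPoly_le d t fun j => ?_) (not_le.2 h0)
    have := hc j
    simpa [fibreCoeff, hx1, Fin.sum_univ_three, ht, hx0] using this
  · have hv : ∀ j, fibreCoeff d t j ![x 0 / x 1, 1] = 0 := fun j => by
      have h := fibreCoeff_smul d t j (x 1) ![x 0 / x 1, 1]
      have e : x 1 • ![x 0 / x 1, 1] = x := by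
        ext i; fin_cases i <;> simp [mul_div_cancel₀, hx1]
      rw [e, hc j] at h
      simpa [hx1] using h.symm
    obtain ⟨g, hg⟩ := kernelPoly_eq_linear_mul_add d t (x 0 / x 1)
    simp only [hv, map_zero, zero_mul, add_zero] at hg
    rcases hirr.isUnit_or_isUnit hg with hu | hu
    -- `X 0 - C z` is not a unit because it vanishes at a point with `x = z`.
    · have := hu.map (eval ![x 0 / x 1, 0])
      simp at this
    · obtain ⟨c, -, rfl⟩ := isUnit_iff_eq_C_of_isReduced.1 hu
      have h2 : degreeOf 1 ((X 0 - C (x 0 / x 1)) * C c : MvPolynomial (Fin 2) ℂ) ≤ 0 := by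
        refine (degreeOf_mul_le _ _ _).trans ?_
        have := degreeOf_sub_le 1 (X 0 : MvPolynomial (Fin 2) ℂ) (C (x 0 / x 1))
        simpa [degreeOf_X] using this
      rw [hg] at h1
      omega

/-! ### The conjugate root by Vieta's formulas -/

/-- The point of the fibre over `x` conjugate to `y`, computed in the chart `y_k ≠ 0`. -/
def conjVec (d : Fin 3 → Fin 3 → ℝ) (t : ℝ) (k : Fin 2) (x y : Fin 2 → ℂ) : Fin 2 → ℂ :=
  if k = 1 then
    ![-(fibreCoeff d t 1 x * y 1) - fibreCoeff d t 2 x * y 0, fibreCoeff d t 2 x * y 1]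
  else ![fibreCoeff d t 0 x * y 0, -(fibreCoeff d t 1 x * y 0) - fibreCoeff d t 0 x * y 1]

/-- If both coordinates vanish, then so do `c₁` and one extreme coefficient; the equation of the
curve at `y` then kills the other one, and the whole form is zero. -/
theorem conjVec_ne_zero {d : Fin 3 → Fin 3 → ℝ} {t : ℝ} (h : FibresProper d t) {k : Fin 2}
    {x y : Fin 2 → ℂ} (hx : x ≠ 0) (hy : y k ≠ 0) (hxy : kernelBar d t x y = 0) :
    conjVec d t k x y ≠ 0 := by
  intro h0
  obtain ⟨j, hj⟩ := h x hx
  apply hj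
  rw [kernelBar_eq] at hxy
  have e0 := congrFun h0 0
  have e1 := congrFun h0 1
  fin_cases k
  · simp only [conjVec, Fin.zero_eta, zero_ne_one, if_false, Matrix.cons_val_zero,
      Matrix.cons_val_one, Pi.zero_apply] at e0 e1 hy
    have c0 : fibreCoeff d t 0 x = 0 := by simpa [hy] using e0
    have c1 : fibreCoeff d t 1 x = 0 := by simpa [hy, c0] using e1
    have c2 : fibreCoeff d t 2 x = 0 := by simpa [hy, c0, c1] using hxy
    fin_cases j <;> assumption
  · simp only [conjVec, Fin.mk_one, if_true, Matrix.cons_val_zero,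
      Matrix.cons_val_one, Pi.zero_apply] at e0 e1 hy
    have c2 : fibreCoeff d t 2 x = 0 := by simpa [hy] using e1
    have c1 : fibreCoeff d t 1 x = 0 := by simpa [hy, c2] using e0
    have c0 : fibreCoeff d t 0 x = 0 := by simpa [hy, c2, c1] using hxy
    fin_cases j <;> assumption

theorem isConj_conjVec {d : Fin 3 → Fin 3 → ℝ} {t : ℝ} {k : Fin 2}
    {x y : Fin 2 → ℂ} (hy : y k ≠ 0) (hxy : kernelBar d t x y = 0) :
    IsConj d t x y (conjVec d t k x y) := by
  rw [kernelBar_eq] at hxy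
  refine ⟨(y k ^ 2)⁻¹, ?_, ?_, ?_⟩ <;> fin_cases k <;> simp [conjVec] at hy ⊢ <;> field_simp <;>
    first | ring1 | linear_combination hxy

/-- Every conjugate of `y` is proportional to the same explicit vector, which gives uniqueness once
that vector is nonzero. -/
theorem IsConj.conjVec_eq {d : Fin 3 → Fin 3 → ℝ} {t : ℝ} {x y z : Fin 2 → ℂ}
    (h : IsConj d t x y z) (k : Fin 2) : ∃ c : ℂ, conjVec d t k x y = c • z := by
  obtain ⟨l, h2, h1, h0⟩ := h
  refine ⟨l * y k ^ 2, ?_⟩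
  ext i
  fin_cases k <;> fin_cases i <;> simp [conjVec, h2, h1, h0] <;> ring

/-! ### Points and charts of the projective line -/

theorem P1.exists_rep_ne_zero (p : P1) : ∃ k : Fin 2, p.rep k ≠ 0 := by
  by_contra! h
  exact p.rep_nonzero (funext h)

theorem P1.eq_iff (p q : P1) : p = q ↔ p.rep 1 * q.rep 0 - p.rep 0 * q.rep 1 = 0 := by
  refine ⟨fun h => by rw [h]; ring, fun h => ?_⟩
  rw [← p.mk_rep, ← q.mk_rep, Projectivization.mk_eq_mk_iff']
  obtain ⟨k, hk⟩ := q.exists_rep_ne_zero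
  refine ⟨p.rep k / q.rep k, ?_⟩
  ext i
  fin_cases k <;> fin_cases i <;> simp at hk ⊢ <;> field_simp <;>
    first | linear_combination h | linear_combination -h

theorem P1.mk_rep_ne_zero_iff (x : Fin 2 → ℂ) (hx : x ≠ 0) (k : Fin 2) :
    (Projectivization.mk ℂ x hx).rep k ≠ 0 ↔ x k ≠ 0 := by
  obtain ⟨a, ha⟩ := Projectivization.exists_smul_eq_mk_rep ℂ x hx
  rw [← ha]
  simp [Units.smul_def]

/-- The homogeneous coordinates of the point with affine coordinate `u` in the chart `x_k ≠ 0`. -/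
def chartVec (k : Fin 2) (u : ℂ) : Fin 2 → ℂ := if k = 1 then ![u, 1] else ![1, u]

theorem chartVec_self (k : Fin 2) (u : ℂ) : chartVec k u k = 1 := by
  fin_cases k <;> simp [chartVec]

theorem chartVec_ne_zero (k : Fin 2) (u : ℂ) : chartVec k u ≠ 0 := fun h =>
  one_ne_zero ((chartVec_self k u).symm.trans (congrFun h k))

theorem chartVec_affCoord {k : Fin 2} {p : P1} (h : p.rep k ≠ 0) :
    chartVec k (affCoord k p) = (p.rep k)⁻¹ • p.rep := by
  ext i
  fin_cases k <;> fin_cases i <;> simp [chartVec, affCoord] at h ⊢ <;> field_simp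

/-- The polynomial functions on a chart that give homogeneous coordinates of the conjugate point. -/
theorem exists_eval_eq_conjVec (d : Fin 3 → Fin 3 → ℝ) (t : ℝ) (k : Fin 2 × Fin 2) :
    ∃ W : Fin 2 → MvPolynomial (Fin 2) ℂ, ∀ w i, eval w (W i) =
      conjVec d t k.2 (chartVec k.1 (w 0)) (chartVec k.2 (w 1)) i := by
  have hv : ∀ k l : Fin 2, ∃ V : Fin 2 → MvPolynomial (Fin 2) ℂ, ∀ w i,
      eval w (V i) = chartVec k (w l) i := fun k l =>
    ⟨if k = 1 then ![X l, 1] else ![1, X l], fun w i => by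
      fin_cases k <;> fin_cases i <;> simp [chartVec]⟩
  obtain ⟨U, hU⟩ := hv k.1 0
  obtain ⟨V, hV⟩ := hv k.2 1
  have hF : ∀ j, ∃ F : MvPolynomial (Fin 2) ℂ, ∀ w,
      eval w F = fibreCoeff d t j (chartVec k.1 (w 0)) := fun j =>
    ⟨(if j = 1 then U 0 * U 1 else 0) - C (t : ℂ) * ∑ i : Fin 3,
      C (d i j : ℂ) * U 0 ^ (i : ℕ) * U 1 ^ (2 - (i : ℕ)), fun w => by
        simp [fibreCoeff, hU, apply_ite (eval w)]⟩
  choose F hF using hF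
  refine ⟨if k.2 = 1 then ![-(F 1 * V 1) - F 2 * V 0, F 2 * V 1]
    else ![F 0 * V 0, -(F 1 * V 0) - F 0 * V 1], fun w i => ?_⟩
  unfold conjVec
  split_ifs <;> fin_cases i <;> simp [hF, hV]

/-! ### Existence and uniqueness of the conjugate point -/

theorem IsConj.chartVec {d : Fin 3 → Fin 3 → ℝ} {t : ℝ} {x y z : P1} {k l : Fin 2}
    (h : IsConj d t x.rep y.rep z.rep) (hx : x.rep k ≠ 0) (hy : y.rep l ≠ 0) :
    IsConj d t (chartVec k (affCoord k x)) (KernelCurve.chartVec l (affCoord l y)) z.rep := by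
  rw [chartVec_affCoord hx, chartVec_affCoord hy]
  simpa using h.smul (x.rep k)⁻¹ (inv_ne_zero hy) one_ne_zero

theorem IsConj.eq_mk_conjVec {d : Fin 3 → Fin 3 → ℝ} {t : ℝ} (hp : FibresProper d t)
    {x y : Fin 2 → ℂ} {z : P1} {k : Fin 2} (h : IsConj d t x y z.rep) (hx : x ≠ 0)
    (hy : y k ≠ 0) : ∃ h0, z = Projectivization.mk ℂ (conjVec d t k x y) h0 := by
  obtain ⟨l, hl⟩ := h.kernelBar_eq
  have h0 := conjVec_ne_zero hp hx hy (by rw [hl]; ring)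
  obtain ⟨c, hc⟩ := h.conjVec_eq k
  exact ⟨h0, by
    conv_lhs => rw [← z.mk_rep]
    exact ((Projectivization.mk_eq_mk_iff' ℂ _ _ _ _).2 ⟨c, hc.symm⟩).symm⟩

theorem IsConj.unique {d : Fin 3 → Fin 3 → ℝ} {t : ℝ} (hp : FibresProper d t)
    {x y z z' : P1} (h : IsConj d t x.rep y.rep z.rep) (h' : IsConj d t x.rep y.rep z'.rep) :
    z = z' := by
  obtain ⟨k, hk⟩ := y.exists_rep_ne_zero
  obtain ⟨_, e⟩ := h.eq_mk_conjVec hp x.rep_nonzero hk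
  obtain ⟨_, e'⟩ := h'.eq_mk_conjVec hp x.rep_nonzero hk
  rw [e, e']

theorem exists_isConj {d : Fin 3 → Fin 3 → ℝ} {t : ℝ} (hp : FibresProper d t)
    (P : P1 × P1) (hP : P ∈ curve d t) : ∃ z : P1, IsConj d t P.1.rep P.2.rep z.rep := by
  obtain ⟨k, hk⟩ := P.2.exists_rep_ne_zero
  have h0 := conjVec_ne_zero hp P.1.rep_nonzero hk hP
  obtain ⟨a, ha⟩ := Projectivization.exists_smul_eq_mk_rep ℂ _ h0
  refine ⟨Projectivization.mk ℂ _ h0, ?_⟩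
  rw [← ha]
  simpa [Units.smul_def] using (isConj_conjVec hk hP).smul 1 one_ne_zero a.ne_zero

theorem IsConj.mem_curve_iff {d : Fin 3 → Fin 3 → ℝ} {t : ℝ} (hp : FibresProper d t)
    {x y z : P1} (h : IsConj d t x.rep y.rep z.rep) (u : P1) :
    (x, u) ∈ curve d t ↔ u = y ∨ u = z := by
  have hl : ∃ l : ℂ, l ≠ 0 ∧ ∀ u, kernelBar d t x.rep u =
      l * ((y.rep 1 * u 0 - y.rep 0 * u 1) * (z.rep 1 * u 0 - z.rep 0 * u 1)) := by
    obtain ⟨l, h2, h1, h0⟩ := h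
    refine ⟨l, ?_, fun u => by rw [KernelCurve.kernelBar_eq, h2, h1, h0]; ring⟩
    -- `IsConj` itself allows the factor `l = 0`; a nonzero form on the fibre rules it out.
    rintro rfl
    obtain ⟨j, hj⟩ := hp _ x.rep_nonzero
    fin_cases j <;> simp_all
  obtain ⟨l, hl0, hl⟩ := hl
  change kernelBar d t x.rep u.rep = 0 ↔ _
  rw [hl, mul_eq_zero, mul_eq_zero, ← P1.eq_iff, ← P1.eq_iff]
  simp [hl0, eq_comm]

/-! ### The switch of the two roots -/

/-- The maps that send each point of the curve to the conjugate point in its fibre. -/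
def IsSwitch (d : Fin 3 → Fin 3 → ℝ) (t : ℝ) (f : curve d t → curve d t) : Prop :=
  ∀ P, (f P).1.1 = P.1.1 ∧ IsConj d t P.1.1.rep P.1.2.rep (f P).1.2.rep

theorem exists_isSwitch {d : Fin 3 → Fin 3 → ℝ} {t : ℝ} (hp : FibresProper d t) :
    ∃ f : curve d t → curve d t, IsSwitch d t f := by
  choose z hz using fun P : curve d t => exists_isConj hp P.1 P.2
  exact ⟨fun P => ⟨(P.1.1, z P), ((hz P).mem_curve_iff hp _).2 (Or.inr rfl)⟩,
    fun P => ⟨rfl, hz P⟩⟩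

namespace IsSwitch

variable {d : Fin 3 → Fin 3 → ℝ} {t : ℝ} {f : curve d t → curve d t}

/-- Conjugacy is symmetric, so `P` and `f (f P)` are both conjugate to `f P`, and the conjugate is
unique. -/
theorem involutive (hp : FibresProper d t) (hf : IsSwitch d t f) : Function.Involutive f := by
  intro P
  obtain ⟨h1, h2⟩ := hf P
  obtain ⟨h3, h4⟩ := hf (f P)
  rw [h1] at h4
  exact Subtype.ext (Prod.ext (h3.trans h1) (h4.unique hp h2.symm))

theorem fibre_eq (hp : FibresProper d t) (hf : IsSwitch d t f) (P : curve d t) :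
    {(P : P1 × P1), (f P : P1 × P1)} = {Q | Q ∈ curve d t ∧ Q.1 = P.1.1} := by
  obtain ⟨h1, h2⟩ := hf P
  ext Q
  obtain ⟨x, u⟩ := Q
  simp only [Set.mem_insert_iff, Set.mem_singleton_iff, Set.mem_ofPred_eq, Prod.ext_iff, h1]
  constructor
  · rintro (⟨rfl, hu⟩ | ⟨rfl, hu⟩)
    · exact ⟨(h2.mem_curve_iff hp _).2 (Or.inl hu), rfl⟩
    · exact ⟨(h2.mem_curve_iff hp _).2 (Or.inr hu), rfl⟩
  · rintro ⟨hu, rfl⟩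
    exact ((h2.mem_curve_iff hp _).1 hu).imp (⟨rfl, ·⟩) (⟨rfl, ·⟩)

theorem isMorphism (hp : FibresProper d t) (hf : IsSwitch d t f) : IsMorphism f := by
  intro P
  obtain ⟨k, hk⟩ := P.1.1.exists_rep_ne_zero
  obtain ⟨k', hk'⟩ := P.1.2.exists_rep_ne_zero
  obtain ⟨l, hl⟩ := (f P).1.2.exists_rep_ne_zero
  obtain ⟨W, hW⟩ := exists_eval_eq_conjVec d t (k, k')
  have key : ∀ Q : curve d t, (Q : P1 × P1) ∈ chart (k, k') → ∃ h0, (f Q).1.2 =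
      Projectivization.mk ℂ (fun i => eval (chartCoord (k, k') Q) (W i)) h0 := by
    intro Q hQ
    have e : (fun i => eval (chartCoord (k, k') Q) (W i)) = conjVec d t k'
        (chartVec k (affCoord k Q.1.1)) (chartVec k' (affCoord k' Q.1.2)) := by
      ext i
      simp [hW, chartCoord]
    rw [e]
    exact ((hf Q).2.chartVec hQ.1 hQ.2).eq_mk_conjVec hp (chartVec_ne_zero _ _)
      (by rw [chartVec_self]; exact one_ne_zero)
  have hP : (P : P1 × P1) ∈ chart (k, k') := ⟨hk, hk'⟩
  -- The unchanged coordinate is written as `X 0 * W l / W l` to share the denominator `W l`, whose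
  -- nonvanishing says exactly that the image lies in the chart `l`.
  refine ⟨(k, k'), (k, l), X 0 * W l, W (1 - l), W l, hP, ⟨by rwa [(hf P).1], hl⟩, ?_, ?_⟩
  · obtain ⟨h0, h⟩ := key P hP
    rwa [h, P1.mk_rep_ne_zero_iff] at hl
  · intro Q hQ hr
    obtain ⟨h0, h⟩ := key Q hQ
    refine ⟨⟨by rw [(hf Q).1]; exact hQ.1, by rwa [h, P1.mk_rep_ne_zero_iff]⟩, ?_⟩
    ext i
    fin_cases i
    · simp [chartCoord, (hf Q).1] at hr ⊢
      rw [mul_div_cancel_right₀ _ hr]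
    · simp only [chartCoord, h, affCoord_mk]
      simp

theorem isAutomorphism (hp : FibresProper d t) (hf : IsSwitch d t f) : IsAutomorphism f :=
  ⟨hf.isMorphism hp, f, hf.isMorphism hp, hf.involutive hp, hf.involutive hp⟩

end IsSwitch

/-! ### Agreement with the explicit formula -/

theorem fibreCoeff_zero_chartVec (d : Fin 3 → Fin 3 → ℝ) (t : ℝ) {x : ℂ} (hx : x ≠ 0) :
    fibreCoeff d t 0 (chartVec 1 x) = -(t * x) * coeffA d 0 x := by
  simp [fibreCoeff, chartVec, coeffA, Fin.sum_univ_three]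
  field_simp

theorem fibreCoeff_two_chartVec (d : Fin 3 → Fin 3 → ℝ) (t : ℝ) {x : ℂ} (hx : x ≠ 0) :
    fibreCoeff d t 2 (chartVec 1 x) = -(t * x) * coeffA d 2 x := by
  simp [fibreCoeff, chartVec, coeffA, Fin.sum_univ_three]
  field_simp

/-- The extreme coefficients are `-tx·A₋₁(x)` and `-tx·A₁(x)`, so their quotient, the product of the
two roots, is `A₋₁(x) / A₁(x)`. -/
theorem IsSwitch.eq_iota1 {d : Fin 3 → Fin 3 → ℝ} {t : ℝ} {f : curve d t → curve d t}
    (ht : t ≠ 0) (hf : IsSwitch d t f) (P : curve d t) (hP : (P : P1 × P1) ∈ iota1Domain d) :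
    (f P : P1 × P1) = iota1 d P := by
  obtain ⟨h1, h2⟩ := hf P
  obtain ⟨hT, hA⟩ := hP
  have hx : affCoord 1 P.1.1 ≠ 0 := div_ne_zero (hT _).1 (hT _).1
  have hy : affCoord 1 P.1.2 ≠ 0 := div_ne_zero (hT _).2 (hT _).2
  obtain ⟨l, e2, -, e0⟩ := h2.chartVec (hT 1).1 (hT 1).2
  rw [fibreCoeff_two_chartVec d t hx] at e2
  rw [fibreCoeff_zero_chartVec d t hx] at e0
  refine Prod.ext h1 ?_
  -- A root at infinity would force `c₂ = 0`, hence `A₁(x) = 0`.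
  have hz : (f P).1.2.rep 1 ≠ 0 := by
    intro h
    simp [h, ht, hx, hA] at e2
  simp only [iota1, ofAffine]
  conv_lhs => rw [← (f P).1.2.mk_rep]
  rw [Projectivization.mk_eq_mk_iff']
  refine ⟨(f P).1.2.rep 1, ?_⟩
  simp only [KernelCurve.chartVec, if_true, Matrix.cons_val_zero, Matrix.cons_val_one] at e2 e0
  have htx : (t : ℂ) * affCoord 1 P.1.1 ≠ 0 := mul_ne_zero (by exact_mod_cast ht) hx
  have hl : l ≠ 0 := by
    rintro rfl
    simp [ht, hx, hA] at e2
  ext i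
  fin_cases i
  · simp
    rw [← mul_div_assoc, div_eq_iff (mul_ne_zero hA hy)]
    apply mul_left_cancel₀ htx
    linear_combination (-(f P).1.2.rep 1) * e0 + (f P).1.2.rep 0 * affCoord 1 P.1.2 * e2
  · simp

/-! ### Exchange of the two coordinates -/

/-- The model with the roles of `x` and `y` exchanged. -/
def transpose (d : Fin 3 → Fin 3 → ℝ) : Fin 3 → Fin 3 → ℝ := fun i j => d j i

theorem kernelPoly_transpose (d : Fin 3 → Fin 3 → ℝ) (t : ℝ) :
    kernelPoly (transpose d) t = rename (Equiv.swap (0 : Fin 2) 1) (kernelPoly d t) := by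
  simp [kernelPoly, transpose, Fin.sum_univ_three]
  ring

theorem kernelBar_transpose (d : Fin 3 → Fin 3 → ℝ) (t : ℝ) (x y : Fin 2 → ℂ) :
    kernelBar (transpose d) t x y = kernelBar d t y x := by
  simp [kernelBar, transpose, Fin.sum_univ_three]
  ring

theorem Degenerate.of_transpose {d : Fin 3 → Fin 3 → ℝ} {t : ℝ}
    (h : Degenerate (transpose d) t) : Degenerate d t := by
  unfold Degenerate at h ⊢
  have hinj := (Equiv.swap (0 : Fin 2) 1).injective
  have h0 := degreeOf_rename_of_injective (p := kernelPoly d t) hinj 0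
  have h1 := degreeOf_rename_of_injective (p := kernelPoly d t) hinj 1
  rw [Equiv.swap_apply_left] at h0
  rw [Equiv.swap_apply_right] at h1
  have hi : Irreducible (rename (Equiv.swap (0 : Fin 2) 1) (kernelPoly d t)) ↔
      Irreducible (kernelPoly d t) :=
    MulEquiv.irreducible_iff (renameEquiv ℂ (Equiv.swap (0 : Fin 2) 1))
  rw [kernelPoly_transpose, h0, h1, hi] at h
  tauto

theorem swap_mem_curve_transpose {d : Fin 3 → Fin 3 → ℝ} {t : ℝ} {P : P1 × P1} :
    P.swap ∈ curve (transpose d) t ↔ P ∈ curve d t := by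
  simp [curve, kernelBar_transpose]

theorem swap_mem_chart {k : Fin 2 × Fin 2} {P : P1 × P1} :
    P.swap ∈ chart k.swap ↔ P ∈ chart k := and_comm

theorem chartCoord_swap (k : Fin 2 × Fin 2) (P : P1 × P1) :
    chartCoord k.swap P.swap = chartCoord k P ∘ Equiv.swap (0 : Fin 2) 1 := by
  ext i
  fin_cases i <;> simp [chartCoord]

theorem swap_mem_iota1Domain {d : Fin 3 → Fin 3 → ℝ} {P : P1 × P1} :
    P.swap ∈ iota1Domain (transpose d) ↔ P ∈ iota2Domain d :=
  and_congr (forall_congr' fun _ => and_comm) Iff.rfl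

/-- The exchange of the two coordinates, as a map between the kernel curves. -/
def curveSwap (d : Fin 3 → Fin 3 → ℝ) (t : ℝ) : curve d t ≃ curve (transpose d) t where
  toFun P := ⟨P.1.swap, swap_mem_curve_transpose.2 P.2⟩
  invFun P := ⟨P.1.swap, swap_mem_curve_transpose.1 P.2⟩
  left_inv _ := rfl
  right_inv _ := rfl

theorem IsMorphism.conj_curveSwap {d : Fin 3 → Fin 3 → ℝ} {t : ℝ}
    {g : curve (transpose d) t → curve (transpose d) t} (hg : IsMorphism g) :
    IsMorphism fun P => (curveSwap d t).symm (g (curveSwap d t P)) := by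
  intro P
  obtain ⟨k, l, p, q, r, h1, h2, h3, h4⟩ := hg (curveSwap d t P)
  have hev : ∀ (Q : P1 × P1) (s : MvPolynomial (Fin 2) ℂ),
      eval (chartCoord k.swap Q) (rename (Equiv.swap (0 : Fin 2) 1) s) =
        eval (chartCoord k Q.swap) s := fun Q s => by
    rw [eval_rename, ← chartCoord_swap]
    rfl
  refine ⟨k.swap, l.swap, rename (Equiv.swap 0 1) q, rename (Equiv.swap 0 1) p,
    rename (Equiv.swap 0 1) r, swap_mem_chart.1 h1, swap_mem_chart.2 h2, ?_, fun Q hQ hr => ?_⟩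
  · rw [hev]
    exact h3
  · rw [hev] at hr
    obtain ⟨h5, h6⟩ := h4 (curveSwap d t Q) (swap_mem_chart.2 hQ) hr
    refine ⟨swap_mem_chart.2 h5, ?_⟩
    change chartCoord l.swap (g (curveSwap d t Q)).1.swap = _
    rw [chartCoord_swap, h6]
    ext i
    fin_cases i <;> simp [hev] <;> rfl

/-! ### Finiteness of the exceptional set -/

theorem finite_quadratic_roots {a b c : ℂ} (h : a ≠ 0 ∨ b ≠ 0 ∨ c ≠ 0) :
    {z : ℂ | a * z ^ 2 + b * z + c = 0}.Finite := by
  set p : Polynomial ℂ := .C a * .X ^ 2 + .C b * .X + .C c with hp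
  have hp0 : p ≠ 0 := by
    intro h0
    have h2 := congrArg (Polynomial.coeff · 2) h0
    have h1 := congrArg (Polynomial.coeff · 1) h0
    have h0 := congrArg (Polynomial.coeff · 0) h0
    simp [hp, Polynomial.coeff_X, Polynomial.coeff_C] at h0 h1 h2
    tauto
  refine (p.rootSet_finite ℂ).subset fun z hz => ?_
  rw [Polynomial.mem_rootSet]
  refine ⟨hp0, ?_⟩
  simpa [hp] using hz

theorem finite_fibre_fst {d : Fin 3 → Fin 3 → ℝ} {t : ℝ} (hp : FibresProper d t) {F : Set P1}
    (hF : F.Finite) : {P | P ∈ curve d t ∧ P.1 ∈ F}.Finite := by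
  have : {P | P ∈ curve d t ∧ P.1 ∈ F} = ⋃ x ∈ F, {P | P ∈ curve d t ∧ P.1 = x} := by
    ext P
    simp
  rw [this]
  refine hF.biUnion fun x _ => ?_
  rcases Set.eq_empty_or_nonempty {P | P ∈ curve d t ∧ P.1 = x} with he | ⟨P, hP, rfl⟩
  · rw [he]
    exact Set.finite_empty
  · obtain ⟨f, hf⟩ := exists_isSwitch hp
    rw [← hf.fibre_eq hp ⟨P, hP⟩]
    exact Set.toFinite _

theorem finite_fibre_snd {d : Fin 3 → Fin 3 → ℝ} {t : ℝ} (hp : FibresProper (transpose d) t)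
    {F : Set P1} (hF : F.Finite) : {P | P ∈ curve d t ∧ P.2 ∈ F}.Finite := by
  refine ((finite_fibre_fst hp hF).image Prod.swap).subset fun P hP => ?_
  exact ⟨P.swap, ⟨swap_mem_curve_transpose.2 hP.1, hP.2⟩, rfl⟩

theorem finite_rep_eq_zero (k : Fin 2) : {p : P1 | p.rep k = 0}.Finite := by
  refine Set.Subsingleton.finite fun p hp q hq => (P1.eq_iff p q).2 ?_
  simp only [Set.mem_ofPred_eq] at hp hq
  fin_cases k <;> simp_all

/-- The excluded points have a coordinate in `{0, ∞}` or satisfy `A₁(x) = 0`. Since `x·A₁(x)` is a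
nonzero polynomial of degree at most 2, only finitely many fibres of the two projections are
involved, and each is finite. -/
theorem finite_curve_diff_iota1Domain {d : Fin 3 → Fin 3 → ℝ} {t : ℝ} (hp : FibresProper d t)
    (hp' : FibresProper (transpose d) t) (hd : ∃ i, d i 2 ≠ 0) :
    (curve d t \ iota1Domain d).Finite := by
  have hq : {z : ℂ | (d 2 2 : ℂ) * z ^ 2 + d 1 2 * z + d 0 2 = 0}.Finite := by
    apply finite_quadratic_roots
    by_contra! h
    obtain ⟨i, hi⟩ := hd
    fin_cases i <;> simp_all
  have hT : ∀ k : Fin 2, {p : P1 | p.rep k = 0}.Finite := finite_rep_eq_zero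
  have hF := (finite_fibre_fst hp (((hT 0).union (hT 1)).union (hq.image ofAffine))).union
    (finite_fibre_snd hp' ((hT 0).union (hT 1)))
  refine hF.subset ?_
  rintro P ⟨hP, hPd⟩
  by_cases hx : P.1.rep 0 = 0 ∨ P.1.rep 1 = 0
  · exact Or.inl ⟨hP, Or.inl hx⟩
  by_cases hy : P.2.rep 0 = 0 ∨ P.2.rep 1 = 0
  · exact Or.inr ⟨hP, hy⟩
  push Not at hx hy
  refine Or.inl ⟨hP, Or.inr ⟨affCoord 1 P.1, ?_, ?_⟩⟩
  · have hA : coeffA d 2 (affCoord 1 P.1) = 0 := by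
      by_contra h
      refine hPd ⟨fun k => ?_, h⟩
      fin_cases k
      exacts [⟨hx.1, hy.1⟩, ⟨hx.2, hy.2⟩]
    have hz : affCoord 1 P.1 ≠ 0 := div_ne_zero hx.1 hx.2
    simp [coeffA, Fin.sum_univ_three] at hA
    field_simp at hA
    simp only [Set.mem_ofPred_eq]
    linear_combination hA
  · conv_rhs => rw [← P.1.mk_rep]
    rw [ofAffine, Projectivization.mk_eq_mk_iff']
    refine ⟨(P.1.rep 1)⁻¹, ?_⟩
    ext i
    fin_cases i <;> simp [affCoord, hx.2, div_eq_inv_mul]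

theorem exists_transpose_ne_zero_of_not_degenerate {d : Fin 3 → Fin 3 → ℝ} {t : ℝ}
    (hnd : ¬ Degenerate d t) : ∃ j, transpose d j 2 ≠ 0 := by
  by_contra! h
  exact hnd (Or.inr (Or.inl (degreeOf_kernelPoly_le d t h)))

end KernelCurve

end

theorem proposition3p1 (d : Fin 3 → Fin 3 → ℝ) (t : ℝ)
    (hd : ∀ i j, d i j ∈ Set.Icc (0 : ℝ) 1)
    (hsum : ∑ i, ∑ j, d i j = 1)
    (ht : t ∈ Set.Ioo (0 : ℝ) 1)
    (htr : Transcendental (KernelCurve.weightField d) t)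
    (hnd : ¬ KernelCurve.Degenerate d t) :
    -- the formula for the first map is defined off a finite subset of the curve, and it extends
    -- to an involutive automorphism of the curve, which switches the two roots in `y`
    ((KernelCurve.curve d t \ KernelCurve.iota1Domain d).Finite ∧
      ∃ f : KernelCurve.curve d t → KernelCurve.curve d t,
        (∀ P : KernelCurve.curve d t, (P : KernelCurve.P1 × KernelCurve.P1) ∈
          KernelCurve.iota1Domain d → (f P : KernelCurve.P1 × KernelCurve.P1) =
            KernelCurve.iota1 d P) ∧
        KernelCurve.IsAutomorphism f ∧ Function.Involutive f ∧
        ∀ P : KernelCurve.curve d t,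
          {(P : KernelCurve.P1 × KernelCurve.P1), (f P : KernelCurve.P1 × KernelCurve.P1)} =
            {Q | Q ∈ KernelCurve.curve d t ∧ Q.1 = P.1.1}) ∧
    -- the same for the second map, which switches the two roots in `x`
    ((KernelCurve.curve d t \ KernelCurve.iota2Domain d).Finite ∧
      ∃ f : KernelCurve.curve d t → KernelCurve.curve d t,
        (∀ P : KernelCurve.curve d t, (P : KernelCurve.P1 × KernelCurve.P1) ∈
          KernelCurve.iota2Domain d → (f P : KernelCurve.P1 × KernelCurve.P1) =
            KernelCurve.iota2 d P) ∧
        KernelCurve.IsAutomorphism f ∧ Function.Involutive f ∧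
        ∀ P : KernelCurve.curve d t,
          {(P : KernelCurve.P1 × KernelCurve.P1), (f P : KernelCurve.P1 × KernelCurve.P1)} =
            {Q | Q ∈ KernelCurve.curve d t ∧ Q.2 = P.1.2}) := by
  have ht0 : t ≠ 0 := ht.1.ne'
  have hnd' : ¬ KernelCurve.Degenerate (KernelCurve.transpose d) t := fun h => hnd h.of_transpose
  have hp := KernelCurve.fibresProper_of_not_degenerate ht0 hnd
  have hp' := KernelCurve.fibresProper_of_not_degenerate ht0 hnd'
  refine ⟨⟨KernelCurve.finite_curve_diff_iota1Domain hp hp'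
    (KernelCurve.exists_transpose_ne_zero_of_not_degenerate hnd'), ?_⟩, ?_, ?_⟩
  · obtain ⟨f, hf⟩ := KernelCurve.exists_isSwitch hp
    exact ⟨f, hf.eq_iota1 ht0, hf.isAutomorphism hp, hf.involutive hp, hf.fibre_eq hp⟩
  · refine ((KernelCurve.finite_curve_diff_iota1Domain hp' hp
      (KernelCurve.exists_transpose_ne_zero_of_not_degenerate hnd)).image Prod.swap).subset ?_
    rintro P ⟨hP, hPd⟩
    exact ⟨P.swap, ⟨KernelCurve.swap_mem_curve_transpose.2 hP,
      fun h => hPd (KernelCurve.swap_mem_iota1Domain.1 h)⟩, rfl⟩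
  -- The second extension is the switch of the transposed model, conjugated by the exchange of
  -- coordinates.
  · obtain ⟨g, hg⟩ := KernelCurve.exists_isSwitch hp'
    have hinv : Function.Involutive fun P =>
        (KernelCurve.curveSwap d t).symm (g (KernelCurve.curveSwap d t P)) := fun P => by
      simp [hg.involutive hp' _]
    have hmor := (hg.isMorphism hp').conj_curveSwap
    refine ⟨_, fun P hP => ?_, ⟨hmor, _, hmor, hinv, hinv⟩, hinv, fun P => ?_⟩
    · exact congrArg Prod.swap (hg.eq_iota1 ht0 (KernelCurve.curveSwap d t P)
        (KernelCurve.swap_mem_iota1Domain.2 hP))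
    · have h := congrArg (Set.image Prod.swap)
        (hg.fibre_eq hp' (KernelCurve.curveSwap d t P))
      rw [Set.image_pair, Set.image_swap_eq_preimage_swap] at h
      refine h.trans ?_
      ext Q
      exact and_congr KernelCurve.swap_mem_curve_transpose Iff.rfl
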